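/- Let $f:\mathbb R^n\to\mathbb R\cup\{+\infty\}$ be a $\nu$-self-concordant barrier ($\nu>0$) for the closure of its domain: $f$ is proper, lower semicontinuous and convex, $\operatorname{dom} f=\{f<+\infty\}$ is open, $f$ is $C^3$ on $\operatorname{dom} f$, every restriction $\varphi(\tau)=f(x+\tau v)$ with $x\in\operatorname{dom}f$, $v\in\mathbb R^n$ satisfies $|\varphi'''(\tau)|\le 2\varphi''(\tau)^{3/2}$ whenever $x+\tau v\in\operatorname{dom} f$, and $\sup_{u\in\mathbb R^n}\{2\nabla f(x)^Tu-u^T\nabla^2 f(x)u\}\le\nu$ for all $x\in\operatorname{dom} f$. Let $g:\mathbb R^n\to\mathbb R\cup\{+\infty\}$ be proper, lower semicontinuous and convex. Write $\|u\|_x=(u^T\nabla^2f(x)u)^{1/2}$ for $x\in\operatorname{dom} f$. Fix $t>0$ and $\delta\ge 0$, and put $F(x;t)=f(x)+t^{-1}g(x)$ and $\operatorname{dom}F=\operatorname{dom}f\cap\operatorname{dom}g$. Let $x_t^*\in\operatorname{dom}F$ be a minimizer of $F(\cdot;t)$ over $\mathbb R^n$, with $\nabla^2 f(x_t^*)\succ0$.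 Let $x_t\in\operatorname{dom}F$ and $$\widehat F(x;t,x_t)=f(x_t)+\nabla f(x_t)^T(x-x_t)+\tfrac12(x-x_t)^T\nabla^2f(x_t)(x-x_t)+t^{-1}g(x).$$ Let $x_t^+\in\operatorname{dom}F$ be a $\delta$-solution of the problem of minimizing $\widehat F(\cdot;t,x_t)$ over $\operatorname{dom}F$, that is, $\widehat F(x_t^+;t,x_t)-\inf_{y\in\operatorname{dom}F}\widehat F(y;t,x_t)\le\delta^2/2$. Put $\lambda_t=\|x_t-x_t^*\|_{x_t^*}$ and $\lambda_t^+=\|x_t^+-x_t^*\|_{x_t^*}$. If $\lambda_t\in[0,1-\tfrac{\sqrt2}{2})$, then $$\lambda_t^+\le\frac{\delta}{1-\lambda_t}+\left(\frac{3-2\lambda_t}{1-4\lambda_t+2\lambda_t^2}\right)\lambda_t^2 .$$ Moreover, the function $(\delta,\lambda)\mapsto\frac{\delta}{1-\lambda}+\frac{3-2\lambda}{1-4\lambda+2\lambda^2}\lambda^2$ is nondecreasing in $\lambda\in[0,1-\tfrac{\sqrt2}{2})$ for each fixed $\delta\ge0$, and nondecreasing in $\delta\ge0$ for each fixed $\lambda\in[0,1-\tfrac{\sqrt2}{2})$.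 -/

import Mathlib

noncomputable section

namespace ProxNewton

/-- Effective domain `{x | f x < +∞}` of an extended-real-valued function. -/
def dom {n : ℕ} (f : EuclideanSpace ℝ (Fin n) → EReal) : Set (EuclideanSpace ℝ (Fin n)) :=
  {x | f x < ⊤}

/-- The real-valued function that agrees with `f` on `dom f` (its values elsewhere are never
used). -/
def realPart {n : ℕ} (f : EuclideanSpace ℝ (Fin n) → EReal) (x : EuclideanSpace ℝ (Fin n)) : ℝ :=
  (f x).toReal

/-- Proper, lower semicontinuous, convex functions `ℝⁿ → ℝ ∪ {+∞}`. -/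
structure IsProperLscConvex {n : ℕ} (f : EuclideanSpace ℝ (Fin n) → EReal) : Prop where
  ne_bot : ∀ x, f x ≠ ⊥
  nonempty_dom : (dom f).Nonempty
  lsc : LowerSemicontinuous f
  convex : ConvexOn ℝ (dom f) (realPart f)

/-- `grad f x u` is `∇f(x)ᵀ u`. -/
def grad {n : ℕ} (f : EuclideanSpace ℝ (Fin n) → EReal) (x u : EuclideanSpace ℝ (Fin n)) : ℝ :=
  fderiv ℝ (realPart f) x u

/-- `hess f x u v` is `uᵀ ∇²f(x) v`. -/
def hess {n : ℕ} (f : EuclideanSpace ℝ (Fin n) → EReal)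
    (x u v : EuclideanSpace ℝ (Fin n)) : ℝ :=
  fderiv ℝ (fderiv ℝ (realPart f)) x u v

/-- `∇²f(x) ≻ 0`. -/
def HessPosDef {n : ℕ} (f : EuclideanSpace ℝ (Fin n) → EReal)
    (x : EuclideanSpace ℝ (Fin n)) : Prop :=
  ∀ u, u ≠ 0 → 0 < hess f x u u

/-- The local norm `‖u‖_x = (uᵀ ∇²f(x) u)^{1/2}`. -/
def localNorm {n : ℕ} (f : EuclideanSpace ℝ (Fin n) → EReal)
    (x u : EuclideanSpace ℝ (Fin n)) : ℝ :=
  Real.sqrt (hess f x u u)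

/-- A convex function `φ` of one real variable with domain `D` is standard self-concordant if
`|φ'''| ≤ 2 (φ'')^{3/2}` on `D`. -/
def IsStdSelfConcordant1D (φ : ℝ → ℝ) (D : Set ℝ) : Prop :=
  ConvexOn ℝ D φ ∧
    ∀ τ ∈ D, |iteratedDeriv 3 φ τ| ≤ 2 * (iteratedDeriv 2 φ τ) ^ (3 / 2 : ℝ)

/-- Standard self-concordant functions: closed convex functions with open domain, three times
continuously differentiable there, whose restriction to every line is standard
self-concordant. -/
structure IsSelfConcordant {n : ℕ} (f : EuclideanSpace ℝ (Fin n) → EReal) : Prop where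
  properLscConvex : IsProperLscConvex f
  isOpen_dom : IsOpen (dom f)
  contDiffOn : ContDiffOn ℝ 3 (realPart f) (dom f)
  line : ∀ x ∈ dom f, ∀ v : EuclideanSpace ℝ (Fin n),
    IsStdSelfConcordant1D (fun τ : ℝ => realPart f (x + τ • v)) {τ : ℝ | x + τ • v ∈ dom f}

/-- `f` is a `ν`-self-concordant barrier for the closure of its domain:
`sup_u {2 ∇f(x)ᵀ u - ‖u‖_x²} ≤ ν` for all `x ∈ dom f`. -/
structure IsSelfConcordantBarrier {n : ℕ} (ν : ℝ)
    (f : EuclideanSpace ℝ (Fin n) → EReal) : Prop where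
  selfConcordant : IsSelfConcordant f
  pos : 0 < ν
  bound : ∀ x ∈ dom f, ∀ u, 2 * grad f x u - hess f x u u ≤ ν

/-- `dom F = dom f ∩ dom g`. -/
def domF {n : ℕ} (f g : EuclideanSpace ℝ (Fin n) → EReal) : Set (EuclideanSpace ℝ (Fin n)) :=
  dom f ∩ dom g

/-- The composite objective `F(x; t) = f(x) + t⁻¹ g(x)`. -/
def objective {n : ℕ} (f g : EuclideanSpace ℝ (Fin n) → EReal) (t : ℝ)
    (x : EuclideanSpace ℝ (Fin n)) : EReal :=
  f x + ((t⁻¹ : ℝ) : EReal) * g x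

/-- `x` solves the problem of minimizing `F(·; t)` over `ℝⁿ`. -/
def IsSolution {n : ℕ} (f g : EuclideanSpace ℝ (Fin n) → EReal) (t : ℝ)
    (x : EuclideanSpace ℝ (Fin n)) : Prop :=
  x ∈ domF f g ∧ ∀ y, objective f g t x ≤ objective f g t y

/-- Second-order Taylor model `Q(x; z)` of `f` around `z`. -/
def quadModel {n : ℕ} (f : EuclideanSpace ℝ (Fin n) → EReal)
    (z x : EuclideanSpace ℝ (Fin n)) : ℝ :=
  realPart f z + grad f z (x - z) + (1 / 2) * hess f z (x - z) (x - z)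

/-- The composite quadratic model `F̂(x; t, z) = Q(x; z) + t⁻¹ g(x)`. -/
def modelObjective {n : ℕ} (f g : EuclideanSpace ℝ (Fin n) → EReal) (t : ℝ)
    (z x : EuclideanSpace ℝ (Fin n)) : EReal :=
  (quadModel f z x : EReal) + ((t⁻¹ : ℝ) : EReal) * g x

/-- `x` is an exact solution of the proximal-Newton subproblem at `z`: a minimizer of
`F̂(·; t, z)` over `dom F`. -/
def IsExactSubproblemSolution {n : ℕ} (f g : EuclideanSpace ℝ (Fin n) → EReal) (t : ℝ)
    (z x : EuclideanSpace ℝ (Fin n)) : Prop :=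
  x ∈ domF f g ∧ ∀ y ∈ domF f g, modelObjective f g t z x ≤ modelObjective f g t z y

/-- `x` is a `δ`-solution of the proximal-Newton subproblem at `z`: it lies in `dom F` and its
value `F̂(x; t, z)` exceeds the optimal value over `dom F` by at most `δ² / 2`. -/
def IsDeltaSolution {n : ℕ} (f g : EuclideanSpace ℝ (Fin n) → EReal) (t δ : ℝ)
    (z x : EuclideanSpace ℝ (Fin n)) : Prop :=
  x ∈ domF f g ∧
    ∀ y ∈ domF f g,
      modelObjective f g t z x ≤ modelObjective f g t z y + ((δ ^ 2 / 2 : ℝ) : EReal)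

/-- Whenever the subproblem has an exact solution `x̄`, a `δ`-solution is a point of `dom F` with
`F̂(x) ≤ F̂(x̄) + δ² / 2`. -/
theorem isDeltaSolution_iff {n : ℕ} {f g : EuclideanSpace ℝ (Fin n) → EReal} {t δ : ℝ}
    {z x xbar : EuclideanSpace ℝ (Fin n)} (h : IsExactSubproblemSolution f g t z xbar) :
    IsDeltaSolution f g t δ z x ↔
      x ∈ domF f g ∧ modelObjective f g t z x ≤
        modelObjective f g t z xbar + ((δ ^ 2 / 2 : ℝ) : EReal) :=
  ⟨fun hx => ⟨hx.1, hx.2 xbar h.1⟩,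
    fun hx => ⟨hx.1, fun y hy => hx.2.trans (add_le_add_left (h.2 y hy) _)⟩⟩

/-- The right-hand side `δ/(1-λ) + ((3-2λ)/(1-4λ+2λ²)) λ²`. -/
def contractionBound (δ lam : ℝ) : ℝ :=
  δ / (1 - lam) + ((3 - 2 * lam) / (1 - 4 * lam + 2 * lam ^ 2)) * lam ^ 2

end ProxNewton

end

/-! Write `x*` for the minimizer, `z` for the current point, `d` for the error of the new point, `p
= z - x*`, `λ = ‖p‖_{x*}`, and `E = (∇f(z) - ∇f(x*) - ∇²f(z)p)ᵀd`. Testing δ-optimality of the model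
against `x*` and adding the first-order condition at `x*` eliminates `g` and leaves `‖d‖_z² ≤ δ² -
2E` (`IsDeltaSolution.hess_add_le`); no exact solution of the subproblem is involved.

Self-concordance supplies two estimates. Local norms at `x*` and `z` compare, `(1-λ)‖d‖_{x*} ≤
‖d‖_z` (`mul_localNorm_le`), and the linearization error is quadratic, `|E| ≤ (λ/(1-λ))²‖d‖_{x*}`
(`abs_grad_sub_sub_hess_le`). The resulting quadratic inequality in `‖d‖_{x*}` gives `δ/(1-λ) +
2λ²/(1-λ)⁴`, which `contractionBound_ge` shows to be at most the stated bound.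

Both estimates need `|D³f[p,u,u]| ≤ 2‖u‖²‖p‖`, while self-concordance on lines controls only
`D³f[v,v,v]`. The passage without loss in the constant is a planar problem about binary cubic forms.
-/

/-! ### Polarization of binary cubic forms with sharp constant. -/

/-- If `(X, Y)` has angle `3γ`, then `T(e₁,e₁,(X,Y))` is a convex combination of the values of the
cubic at the angles `γ` and `γ ± 2π/3`. -/
theorem abs_cubic_polar_le_of_abs_cubic_le {a b c d K : ℝ}
    (h : ∀ x y : ℝ, x ^ 2 + y ^ 2 = 1 →
      |a * x ^ 3 + 3 * b * (x ^ 2 * y) + 3 * c * (x * y ^ 2) + d * y ^ 3| ≤ K)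
    {X Y : ℝ} (hXY : X ^ 2 + Y ^ 2 = 1) : |a * X + b * Y| ≤ K := by
  obtain ⟨γ, hX, hY⟩ : ∃ γ : ℝ, Real.cos (3 * γ) = X ∧ Real.sin (3 * γ) = Y := by
    have hn : ‖(⟨X, Y⟩ : ℂ)‖ = 1 := by
      rw [Complex.norm_eq_sqrt_sq_add_sq, hXY, Real.sqrt_one]
    refine ⟨Complex.arg ⟨X, Y⟩ / 3, ?_, ?_⟩
    · have := Complex.norm_mul_cos_arg ⟨X, Y⟩
      rw [hn, one_mul] at this
      rw [mul_div_cancel₀ _ three_ne_zero, this]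
    · have := Complex.norm_mul_sin_arg ⟨X, Y⟩
      rw [hn, one_mul] at this
      rw [mul_div_cancel₀ _ three_ne_zero, this]
  rw [Real.cos_three_mul] at hX
  rw [Real.sin_three_mul] at hY
  have hcs := Real.sin_sq_add_cos_sq γ
  set p := Real.cos γ
  set q := Real.sin γ
  -- `w` plays `√3` in the rotations by `±2π/3`; only `w² = 3` matters.
  obtain ⟨w, hw⟩ : ∃ w : ℝ, w ^ 2 = 3 := ⟨√3, Real.sq_sqrt (by norm_num)⟩
  have h0 := h p q (by linarith)
  have h1 := h (-p / 2 - w / 2 * q) (-q / 2 + w / 2 * p) (by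
    linear_combination (1 / 4 * (p ^ 2 + q ^ 2)) * hw + hcs)
  have h2 := h (-p / 2 + w / 2 * q) (-q / 2 - w / 2 * p) (by
    linear_combination (1 / 4 * (p ^ 2 + q ^ 2)) * hw + hcs)
  set V0 := a * p ^ 3 + 3 * b * (p ^ 2 * q) + 3 * c * (p * q ^ 2) + d * q ^ 3 with hV0
  set V1 := a * (-p / 2 - w / 2 * q) ^ 3
    + 3 * b * ((-p / 2 - w / 2 * q) ^ 2 * (-q / 2 + w / 2 * p))
    + 3 * c * ((-p / 2 - w / 2 * q) * (-q / 2 + w / 2 * p) ^ 2)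
    + d * (-q / 2 + w / 2 * p) ^ 3 with hV1
  set V2 := a * (-p / 2 + w / 2 * q) ^ 3
    + 3 * b * ((-p / 2 + w / 2 * q) ^ 2 * (-q / 2 - w / 2 * p))
    + 3 * c * ((-p / 2 + w / 2 * q) * (-q / 2 - w / 2 * p) ^ 2)
    + d * (-q / 2 - w / 2 * p) ^ 3 with hV2
  -- The weight at angle `θ` is `((4cos²θ - 1)/3)²`, simplified with `p² + q² = 1`.
  set W0 := (3 * p ^ 2 - q ^ 2) ^ 2 / 9 with hW0
  set W1 := (2 * q * (q + w * p)) ^ 2 / 9 with hW1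
  set W2 := (2 * q * (q - w * p)) ^ 2 / 9 with hW2
  have hw4 : w ^ 4 = 9 := by rw [show w ^ 4 = (w ^ 2) ^ 2 by ring, hw]; norm_num
  have hpq : p ^ 2 + q ^ 2 = 1 := by linarith
  have hsum : W0 + W1 + W2 = 1 := by
    have : W0 + W1 + W2 = (9 * p ^ 4 - 6 * p ^ 2 * q ^ 2 + 9 * q ^ 4
        + 8 * p ^ 2 * q ^ 2 * w ^ 2) / 9 := by
      rw [hW0, hW1, hW2]; ring
    rw [this, hw]
    linear_combination (p ^ 2 + q ^ 2 + 1) * hpq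
  have hcomb : a * X + b * Y = W0 * V0 + W1 * V1 + W2 * V2 := by
    -- The factor `(p² + q²)² = 1` makes both sides homogeneous of degree 7, so `ring` can compare
    -- them.
    have hX' : X = (p ^ 2 + q ^ 2) ^ 2 * (p ^ 3 - 3 * p * q ^ 2) := by
      rw [hpq, ← hX]
      linear_combination 3 * p * hpq
    have hY' : Y = (p ^ 2 + q ^ 2) ^ 2 * (3 * p ^ 2 * q - q ^ 3) := by
      rw [hpq, ← hY]
      linear_combination -3 * q * hpq
    rw [hX', hY', hV0, hV1, hV2, hW0, hW1, hW2]
    ring_nf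
    rw [hw, hw4]
    ring
  rw [hcomb]
  calc |W0 * V0 + W1 * V1 + W2 * V2| ≤ |W0 * V0| + |W1 * V1| + |W2 * V2| := abs_add_three _ _ _
    _ = W0 * |V0| + W1 * |V1| + W2 * |V2| := by
      rw [abs_mul, abs_mul, abs_mul, abs_of_nonneg (by positivity : 0 ≤ W0),
        abs_of_nonneg (by positivity : 0 ≤ W1), abs_of_nonneg (by positivity : 0 ≤ W2)]
    _ ≤ W0 * K + W1 * K + W2 * K := by gcongr
    _ = K := by rw [← add_mul, ← add_mul, hsum, one_mul]

/-- Gram–Schmidt for `q` turns the plane into a Euclidean one and reduces to the unit circle. -/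
theorem abs_polar_le_of_posDef {a b c d A B C : ℝ} (hA : 0 < A) (hB : B ^ 2 < A * C)
    (h : ∀ s t : ℝ, |a * s ^ 3 + 3 * b * (s ^ 2 * t) + 3 * c * (s * t ^ 2) + d * t ^ 3| ≤
      2 * ((A * s ^ 2 + 2 * B * (s * t) + C * t ^ 2)
        * √(A * s ^ 2 + 2 * B * (s * t) + C * t ^ 2))) :
    |b| ≤ 2 * (A * √C) := by
  obtain ⟨α, hα, hαA⟩ : ∃ α : ℝ, 0 < α ∧ α ^ 2 = A :=
    ⟨√A, Real.sqrt_pos.2 hA, Real.sq_sqrt hA.le⟩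
  have hC : 0 < C := by
    by_contra hC
    nlinarith [mul_nonneg hA.le (neg_nonneg.2 (not_lt.1 hC)), sq_nonneg B]
  obtain ⟨κ, hκ, hκC⟩ : ∃ κ : ℝ, 0 < κ ∧ κ ^ 2 = C :=
    ⟨√C, Real.sqrt_pos.2 hC, Real.sq_sqrt hC.le⟩
  have hD : 0 < C - B ^ 2 / A := by
    rw [sub_pos, div_lt_iff₀ hA]; linarith
  obtain ⟨η, hη, hηD⟩ : ∃ η : ℝ, 0 < η ∧ η ^ 2 = C - B ^ 2 / A :=
    ⟨_, Real.sqrt_pos.2 hD, Real.sq_sqrt hD.le⟩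
  have hsqC : √C = κ := by rw [← hκC, Real.sqrt_sq hκ.le]
  subst hαA
  subst hκC
  have hη2 : α ^ 2 * η ^ 2 = α ^ 2 * κ ^ 2 - B ^ 2 := by
    rw [hηD]; field_simp
  -- The coefficients are those of the cubic in the basis `u/α`, `(p - (B/α²)u)/η`, orthonormal for
  -- `q`; there `p/κ` has coordinates `(B/(ακ), η/κ)`.
  have key := abs_cubic_polar_le_of_abs_cubic_le (a := a / α ^ 3)
    (b := (b - B / α ^ 2 * a) / (α ^ 2 * η))
    (c := (c - 2 * (B / α ^ 2) * b + (B / α ^ 2) ^ 2 * a) / (α * η ^ 2))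
    (d := (d - 3 * (B / α ^ 2) * c + 3 * (B / α ^ 2) ^ 2 * b - (B / α ^ 2) ^ 3 * a) / η ^ 3)
    (K := 2) (fun x y hxy => by
      have h1 := h (x / α - B / α ^ 2 * (y / η)) (y / η)
      have hq : α ^ 2 * (x / α - B / α ^ 2 * (y / η)) ^ 2
          + 2 * B * ((x / α - B / α ^ 2 * (y / η)) * (y / η)) + κ ^ 2 * (y / η) ^ 2 = 1 := by
        rw [← hxy]
        field_simp
        linear_combination (-y ^ 2) * hη2
      rw [hq, Real.sqrt_one] at h1
      convert h1 using 2
      · field_simp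
        ring
      · norm_num) (X := B / (α * κ)) (Y := η / κ) (by
      field_simp
      linear_combination hη2)
  have hb : b = α ^ 2 * κ * (a / α ^ 3 * (B / (α * κ))
      + (b - B / α ^ 2 * a) / (α ^ 2 * η) * (η / κ)) := by
    field_simp
    ring
  rw [hsqC, hb, abs_mul, abs_of_pos (by positivity)]
  calc _ ≤ α ^ 2 * κ * 2 := by gcongr
    _ = _ := by ring

/-- If the cubic form `T(v,v,v)` is bounded by `2 q(v)^{3/2}` on a plane, for a positive semidefinite
quadratic form `q`, then `|T(u,u,p)| ≤ 2 q(u) √q(p)`. -/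
theorem abs_polar_le_of_posSemidef {a b c d A B C : ℝ} (hA : 0 ≤ A) (hC : 0 ≤ C)
    (hB : B ^ 2 ≤ A * C)
    (h : ∀ s t : ℝ, |a * s ^ 3 + 3 * b * (s ^ 2 * t) + 3 * c * (s * t ^ 2) + d * t ^ 3| ≤
      2 * ((A * s ^ 2 + 2 * B * (s * t) + C * t ^ 2)
        * √(A * s ^ 2 + 2 * B * (s * t) + C * t ^ 2))) :
    |b| ≤ 2 * (A * √C) := by
  -- Adding `ε` to both diagonal entries makes the form definite and only weakens the cubic bound.
  have key : ∀ ε : ℝ, 0 < ε → |b| ≤ 2 * ((A + ε) * √(C + ε)) := by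
    intro ε hε
    refine abs_polar_le_of_posDef (a := a) (c := c) (d := d) (B := B) (by positivity)
      (by nlinarith) fun s t => (h s t).trans ?_
    have hle : A * s ^ 2 + 2 * B * (s * t) + C * t ^ 2
        ≤ (A + ε) * s ^ 2 + 2 * B * (s * t) + (C + ε) * t ^ 2 := by
      nlinarith [sq_nonneg s, sq_nonneg t]
    have h0 : 0 ≤ (A + ε) * s ^ 2 + 2 * B * (s * t) + (C + ε) * t ^ 2 := by
      rcases le_total 0 (A * s ^ 2 + 2 * B * (s * t) + C * t ^ 2) with h1 | h1
      · exact h1.trans hle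
      · have hAε : 0 < A + ε := by positivity
        have : 0 ≤ (A + ε) * ((A + ε) * s ^ 2 + 2 * B * (s * t) + (C + ε) * t ^ 2) := by
          have : B ^ 2 ≤ (A + ε) * (C + ε) := by nlinarith
          nlinarith [sq_nonneg ((A + ε) * s + B * t), mul_nonneg (sub_nonneg.2 this) (sq_nonneg t)]
        exact nonneg_of_mul_nonneg_right this hAε
    gcongr
  have hlim : Filter.Tendsto (fun ε : ℝ => 2 * ((A + ε) * √(C + ε))) (nhdsWithin 0 (Set.Ioi 0))
      (nhds (2 * (A * √C))) := by
    have : Continuous fun ε : ℝ => 2 * ((A + ε) * √(C + ε)) := by fun_prop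
    simpa using (this.tendsto 0).mono_left nhdsWithin_le_nhds
  exact ge_of_tendsto hlim (Filter.eventually_of_mem self_mem_nhdsWithin key)

/-! ### Scalar differential inequalities on `[0, 1]`. -/

/-- The hypothesis says that `ψ^(-1/2)` has slope at least `-1`. It is applied to the squared local
norm of the direction of a segment. -/
theorem sqrt_le_div_of_abs_deriv_le {ψ ψ' : ℝ → ℝ}
    (hd : ∀ τ ∈ Set.Icc (0 : ℝ) 1, HasDerivAt ψ (ψ' τ) τ)
    (h0 : ∀ τ ∈ Set.Icc (0 : ℝ) 1, 0 ≤ ψ τ)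
    (hb : ∀ τ ∈ Set.Icc (0 : ℝ) 1, |ψ' τ| ≤ 2 * (ψ τ * √(ψ τ)))
    (hr : √(ψ 0) < 1) {τ : ℝ} (hτ : τ ∈ Set.Icc (0 : ℝ) 1) :
    √(ψ τ) ≤ √(ψ 0) / (1 - √(ψ 0) * τ) := by
  -- The shift by `ε` keeps the root away from `0`; the division-free form survives the limit even
  -- where `ψ` vanishes.
  have key : ∀ ε : ℝ, 0 < ε → √(ψ τ + ε) ≤ √(ψ 0 + ε) * (1 + τ * √(ψ τ + ε)) := by
    intro ε hε
    have hpos : ∀ σ ∈ Set.Icc (0 : ℝ) 1, 0 < ψ σ + ε := fun σ hσ => by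
      have := h0 σ hσ; positivity
    have hder : ∀ σ ∈ Set.Icc (0 : ℝ) 1, HasDerivAt (fun σ => (√(ψ σ + ε))⁻¹ + σ)
        (-(ψ' σ / (2 * √(ψ σ + ε))) / √(ψ σ + ε) ^ 2 + 1) σ := fun σ hσ =>
      ((((hd σ hσ).add_const ε).sqrt (hpos σ hσ).ne').fun_inv
        (Real.sqrt_pos.2 (hpos σ hσ)).ne').add (hasDerivAt_id σ)
    have hmono : MonotoneOn (fun σ => (√(ψ σ + ε))⁻¹ + σ) (Set.Icc (0 : ℝ) 1) := by
      refine monotoneOn_of_hasDerivWithinAt_nonneg (convex_Icc 0 1)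
        (fun σ hσ => (hder σ hσ).continuousAt.continuousWithinAt)
        (fun σ hσ => (hder σ (interior_subset hσ)).hasDerivWithinAt) fun σ hσ => ?_
      replace hσ := interior_subset hσ
      have hp := Real.sqrt_pos.2 (hpos σ hσ)
      have hle : ψ' σ ≤ 2 * √(ψ σ + ε) ^ 3 := by
        calc ψ' σ ≤ |ψ' σ| := le_abs_self _
          _ ≤ 2 * (ψ σ * √(ψ σ)) := hb σ hσ
          _ ≤ 2 * ((ψ σ + ε) * √(ψ σ + ε)) := by
            have := h0 σ hσ
            have h1 : ψ σ ≤ ψ σ + ε := by linarith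
            gcongr
          _ = 2 * √(ψ σ + ε) ^ 3 := by
            rw [pow_succ, Real.sq_sqrt (hpos σ hσ).le]
      have : -(ψ' σ / (2 * √(ψ σ + ε))) / √(ψ σ + ε) ^ 2 + 1
          = (2 * √(ψ σ + ε) ^ 3 - ψ' σ) / (2 * √(ψ σ + ε) ^ 3) := by
        field_simp
        ring
      rw [this]
      exact div_nonneg (sub_nonneg.2 hle) (by positivity)
    have h1 := hmono ⟨le_rfl, zero_le_one⟩ hτ hτ.1
    have hp0 := Real.sqrt_pos.2 (hpos 0 ⟨le_rfl, zero_le_one⟩)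
    have hpτ := Real.sqrt_pos.2 (hpos τ hτ)
    simp only [add_zero] at h1
    have h2 := mul_le_mul_of_nonneg_left h1 (mul_pos hp0 hpτ).le
    have e1 : √(ψ 0 + ε) * √(ψ τ + ε) * (√(ψ 0 + ε))⁻¹ = √(ψ τ + ε) := by field_simp
    have e2 : √(ψ 0 + ε) * √(ψ τ + ε) * ((√(ψ τ + ε))⁻¹ + τ)
      = √(ψ 0 + ε) * (1 + τ * √(ψ τ + ε)) := by field_simp
    rwa [e1, e2] at h2
  have hc1 : Continuous fun ε : ℝ => √(ψ τ + ε) := by fun_prop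
  have hc2 : Continuous fun ε : ℝ => √(ψ 0 + ε) * (1 + τ * √(ψ τ + ε)) := by fun_prop
  have hlim : √(ψ τ) ≤ √(ψ 0) * (1 + τ * √(ψ τ)) := by
    simpa using le_of_tendsto_of_tendsto (b := nhdsWithin (0 : ℝ) (Set.Ioi 0))
      ((hc1.tendsto 0).mono_left nhdsWithin_le_nhds)
      ((hc2.tendsto 0).mono_left nhdsWithin_le_nhds)
      (Filter.eventually_of_mem self_mem_nhdsWithin key)
  have hden : 0 < 1 - √(ψ 0) * τ := by nlinarith [hτ.1, hτ.2, Real.sqrt_nonneg (ψ 0)]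
  rw [le_div_iff₀ hden]
  linarith

theorem one_sub_mul_pos {r τ : ℝ} (hr0 : 0 ≤ r) (hr1 : r < 1) (hτ : τ ∈ Set.Icc (0 : ℝ) 1) :
    0 < 1 - r * τ := by
  nlinarith [hτ.1, hτ.2]

/-- Grönwall: `h/(1-rτ)²` increases and `h(1-rτ)²` decreases. -/
theorem le_and_le_of_abs_deriv_le {h h' : ℝ → ℝ} {r : ℝ} (hr0 : 0 ≤ r) (hr1 : r < 1)
    (hd : ∀ τ ∈ Set.Icc (0 : ℝ) 1, HasDerivAt h (h' τ) τ)
    (hb : ∀ τ ∈ Set.Icc (0 : ℝ) 1, |h' τ| ≤ 2 * (h τ * (r / (1 - r * τ))))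
    {τ : ℝ} (hτ : τ ∈ Set.Icc (0 : ℝ) 1) :
    h 0 * (1 - r * τ) ^ 2 ≤ h τ ∧ h τ * (1 - r * τ) ^ 2 ≤ h 0 := by
  have hlin : ∀ σ : ℝ, HasDerivAt (fun σ : ℝ => 1 - r * σ) (-r) σ := fun σ => by
    simpa using ((hasDerivAt_id σ).const_mul r).const_sub 1
  have hp : ∀ σ ∈ Set.Icc (0 : ℝ) 1, 0 < 1 - r * σ := fun σ hσ => one_sub_mul_pos hr0 hr1 hσ
  constructor
  · have hder : ∀ σ ∈ Set.Icc (0 : ℝ) 1, HasDerivAt (fun σ => h σ / (1 - r * σ) ^ 2)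
        ((h' σ * (1 - r * σ) ^ 2 - h σ * (2 * (1 - r * σ) * (-r))) / ((1 - r * σ) ^ 2) ^ 2) σ :=
      fun σ hσ => by
        have h2 := (hlin σ).fun_pow 2
        simp only [Nat.cast_ofNat, Nat.add_one_sub_one, pow_one] at h2
        exact (hd σ hσ).fun_div h2 (pow_pos (hp σ hσ) 2).ne'
    have hmono : MonotoneOn (fun σ => h σ / (1 - r * σ) ^ 2) (Set.Icc (0 : ℝ) 1) := by
      refine monotoneOn_of_hasDerivWithinAt_nonneg (convex_Icc 0 1)
        (fun σ hσ => (hder σ hσ).continuousAt.continuousWithinAt)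
        (fun σ hσ => (hder σ (interior_subset hσ)).hasDerivWithinAt) fun σ hσ => ?_
      replace hσ := interior_subset hσ
      have hpσ := hp σ hσ
      have h1 := (abs_le.1 (hb σ hσ)).1
      have h2 := mul_le_mul_of_nonneg_right h1 (pow_pos hpσ 2).le
      refine div_nonneg ?_ (by positivity)
      have e : -(2 * (h σ * (r / (1 - r * σ)))) * (1 - r * σ) ^ 2
        = h σ * (2 * (1 - r * σ) * (-r)) := by field_simp
      linarith
    have h1 := hmono ⟨le_rfl, zero_le_one⟩ hτ hτ.1
    simp only [mul_zero, sub_zero, one_pow, div_one] at h1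
    rwa [le_div_iff₀ (pow_pos (hp τ hτ) 2)] at h1
  · have hder : ∀ σ ∈ Set.Icc (0 : ℝ) 1, HasDerivAt (fun σ => h σ * (1 - r * σ) ^ 2)
        (h' σ * (1 - r * σ) ^ 2 + h σ * (2 * (1 - r * σ) * (-r))) σ :=
      fun σ hσ => by
        have h2 := (hlin σ).fun_pow 2
        simp only [Nat.cast_ofNat, Nat.add_one_sub_one, pow_one] at h2
        exact (hd σ hσ).fun_mul h2
    have hmono : AntitoneOn (fun σ => h σ * (1 - r * σ) ^ 2) (Set.Icc (0 : ℝ) 1) := by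
      refine antitoneOn_of_hasDerivWithinAt_nonpos (convex_Icc 0 1)
        (fun σ hσ => (hder σ hσ).continuousAt.continuousWithinAt)
        (fun σ hσ => (hder σ (interior_subset hσ)).hasDerivWithinAt) fun σ hσ => ?_
      replace hσ := interior_subset hσ
      have hpσ := hp σ hσ
      have h1 := (abs_le.1 (hb σ hσ)).2
      have h2 := mul_le_mul_of_nonneg_right h1 (pow_pos hpσ 2).le
      have e : 2 * (h σ * (r / (1 - r * σ))) * (1 - r * σ) ^ 2
        = -(h σ * (2 * (1 - r * σ) * (-r))) := by field_simp
      linarith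
    have h1 := hmono ⟨le_rfl, zero_le_one⟩ hτ hτ.1
    simpa using h1

/-- The bound on `k'` is the exact derivative of `(rτ/(1-rτ))² N`, which vanishes at `0`. -/
theorem abs_le_of_abs_deriv_le_cubic {k k' : ℝ → ℝ} {r N : ℝ} (hr0 : 0 ≤ r) (hr1 : r < 1)
    (hk0 : k 0 = 0)
    (hd : ∀ τ ∈ Set.Icc (0 : ℝ) 1, HasDerivAt k (k' τ) τ)
    (hb : ∀ τ ∈ Set.Icc (0 : ℝ) 1, |k' τ| ≤ 2 * r ^ 2 * τ / (1 - r * τ) ^ 3 * N) :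
    |k 1| ≤ (r / (1 - r)) ^ 2 * N := by
  have hlin : ∀ σ : ℝ, HasDerivAt (fun σ : ℝ => 1 - r * σ) (-r) σ := fun σ => by
    simpa using ((hasDerivAt_id σ).const_mul r).const_sub 1
  have hlin' : ∀ σ : ℝ, HasDerivAt (fun σ : ℝ => r * σ) r σ := fun σ => by
    simpa using (hasDerivAt_id σ).const_mul r
  have hder : ∀ σ ∈ Set.Icc (0 : ℝ) 1, HasDerivAt (fun σ => (r * σ / (1 - r * σ)) ^ 2 * N)
      (2 * r ^ 2 * σ / (1 - r * σ) ^ 3 * N) σ := fun σ hσ => by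
    have hp := one_sub_mul_pos hr0 hr1 hσ
    have := (((hlin' σ).fun_div (hlin σ) hp.ne').fun_pow 2).mul_const N
    refine this.congr_deriv ?_
    have hp' := hp.ne'
    simp only [Nat.cast_ofNat, Nat.add_one_sub_one, pow_one]
    field_simp
    ring
  have := image_norm_le_of_norm_deriv_right_le_deriv_boundary' (f := k) (f' := k') (a := 0) (b := 1)
    (fun τ hτ => (hd τ hτ).continuousAt.continuousWithinAt)
    (fun τ hτ => (hd τ (Set.Ico_subset_Icc_self hτ)).hasDerivWithinAt)
    (B := fun σ => (r * σ / (1 - r * σ)) ^ 2 * N) (by simp [hk0])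
    (fun τ hτ => (hder τ hτ).continuousAt.continuousWithinAt)
    (fun τ hτ => (hder τ (Set.Ico_subset_Icc_self hτ)).hasDerivWithinAt)
    (fun τ hτ => hb τ (Set.Ico_subset_Icc_self hτ)) (x := 1) ⟨zero_le_one, le_rfl⟩
  simpa using this

/-! ### Third derivatives and restrictions to lines. -/

section Smooth

variable {E : Type*} [NormedAddCommGroup E] [NormedSpace ℝ E] {F : E → ℝ} {y : E}

/-- The third derivative of `F` at `y` as a trilinear form. -/
noncomputable def thirdDeriv (F : E → ℝ) (y p u v : E) : ℝ :=
  fderiv ℝ (fderiv ℝ (fderiv ℝ F)) y p u v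

theorem ContDiffAt.fderiv_of_three (hF : ContDiffAt ℝ 3 F y) : ContDiffAt ℝ 2 (fderiv ℝ F) y :=
  hF.fderiv_right (by norm_num)

theorem ContDiffAt.fderiv_fderiv_of_three (hF : ContDiffAt ℝ 3 F y) :
    ContDiffAt ℝ 1 (fderiv ℝ (fderiv ℝ F)) y :=
  hF.fderiv_of_three.fderiv_right (by norm_num)

theorem hasDerivAt_line (x p : E) (τ : ℝ) : HasDerivAt (fun τ : ℝ => x + τ • p) p τ := by
  simpa using ((hasDerivAt_id τ).smul_const p).const_add x

theorem ContDiffAt.hasDerivAt_line {x p : E} {τ : ℝ} (hF : ContDiffAt ℝ 3 F (x + τ • p)) :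
    HasDerivAt (fun τ : ℝ => F (x + τ • p)) (fderiv ℝ F (x + τ • p) p) τ :=
  (hF.differentiableAt (by norm_num)).hasFDerivAt.comp_hasDerivAt τ (_root_.hasDerivAt_line x p τ)

theorem ContDiffAt.hasDerivAt_fderiv_line {x p : E} {τ : ℝ} (hF : ContDiffAt ℝ 3 F (x + τ • p))
    (u : E) : HasDerivAt (fun τ : ℝ => fderiv ℝ F (x + τ • p) u)
      (fderiv ℝ (fderiv ℝ F) (x + τ • p) p u) τ := by
  have h := (hF.fderiv_of_three.differentiableAt (by norm_num)).hasFDerivAt.comp_hasDerivAt τ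
    (_root_.hasDerivAt_line x p τ)
  simpa using h.clm_apply (hasDerivAt_const τ u)

theorem ContDiffAt.hasDerivAt_fderiv_fderiv_line {x p : E} {τ : ℝ}
    (hF : ContDiffAt ℝ 3 F (x + τ • p)) (u v : E) :
    HasDerivAt (fun τ : ℝ => fderiv ℝ (fderiv ℝ F) (x + τ • p) u v)
      (thirdDeriv F (x + τ • p) p u v) τ := by
  have h := (hF.fderiv_fderiv_of_three.differentiableAt (by norm_num)).hasFDerivAt.comp_hasDerivAt τ
    (_root_.hasDerivAt_line x p τ)
  have h1 := h.clm_apply (hasDerivAt_const τ u)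
  simpa [thirdDeriv] using h1.clm_apply (hasDerivAt_const τ v)

theorem ContDiffAt.fderiv_fderiv_comm (hF : ContDiffAt ℝ 3 F y) (u v : E) :
    fderiv ℝ (fderiv ℝ F) y u v = fderiv ℝ (fderiv ℝ F) y v u :=
  (hF.isSymmSndFDerivAt (by simp; norm_num)) u v

theorem ContDiffAt.thirdDeriv_comm_left (hF : ContDiffAt ℝ 3 F y) (p u v : E) :
    thirdDeriv F y p u v = thirdDeriv F y u p v := by
  have := (hF.fderiv_of_three.isSymmSndFDerivAt (by simp)) p u
  exact congrArg (fun l : E →L[ℝ] ℝ => l v) this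

/-- The second derivative is symmetric near `y`, and this identity is differentiated in direction
`p`. -/
theorem ContDiffAt.thirdDeriv_comm_right (hF : ContDiffAt ℝ 3 F y) (p u v : E) :
    thirdDeriv F y p u v = thirdDeriv F y p v u := by
  have hy : ContDiffAt ℝ 3 F (y + (0 : ℝ) • p) := by simpa using hF
  have h1 := hy.hasDerivAt_fderiv_fderiv_line u v
  have h2 := hy.hasDerivAt_fderiv_fderiv_line v u
  have hc : Filter.Tendsto (fun τ : ℝ => y + τ • p) (nhds 0) (nhds (y + (0 : ℝ) • p)) :=
    (_root_.hasDerivAt_line y p 0).continuousAt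
  have hev : (fun τ : ℝ => fderiv ℝ (fderiv ℝ F) (y + τ • p) v u)
      =ᶠ[nhds 0] fun τ : ℝ => fderiv ℝ (fderiv ℝ F) (y + τ • p) u v := by
    filter_upwards [hc.eventually (hy.eventually (by simp))] with τ hτ
    exact hτ.fderiv_fderiv_comm v u
  have := h1.unique (h2.congr_of_eventuallyEq hev.symm)
  simpa using this

theorem thirdDeriv_line_expand (hF : ContDiffAt ℝ 3 F y) (s t : ℝ) (u p : E) :
    thirdDeriv F y (s • u + t • p) (s • u + t • p) (s • u + t • p) =
      thirdDeriv F y u u u * s ^ 3 + 3 * thirdDeriv F y p u u * (s ^ 2 * t)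
        + 3 * thirdDeriv F y u p p * (s * t ^ 2) + thirdDeriv F y p p p * t ^ 3 := by
  have e1 : thirdDeriv F y u p u = thirdDeriv F y p u u := hF.thirdDeriv_comm_left u p u
  have e2 : thirdDeriv F y u u p = thirdDeriv F y p u u := by
    rw [hF.thirdDeriv_comm_right, e1]
  have e3 : thirdDeriv F y p u p = thirdDeriv F y u p p := hF.thirdDeriv_comm_left p u p
  have e4 : thirdDeriv F y p p u = thirdDeriv F y u p p := by
    rw [hF.thirdDeriv_comm_right, e3]
  have : thirdDeriv F y (s • u + t • p) (s • u + t • p) (s • u + t • p) =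
      s ^ 3 * thirdDeriv F y u u u + s ^ 2 * t * (thirdDeriv F y u u p + thirdDeriv F y u p u
        + thirdDeriv F y p u u) + s * t ^ 2 * (thirdDeriv F y u p p + thirdDeriv F y p u p
        + thirdDeriv F y p p u) + t ^ 3 * thirdDeriv F y p p p := by
    simp only [thirdDeriv, map_add, map_smul, add_apply, smul_apply, smul_eq_mul]
    ring
  rw [this, e1, e2, e3, e4]
  ring

theorem iteratedDeriv_line (hF : ContDiffAt ℝ 3 F y) (v : E) :
    iteratedDeriv 2 (fun τ : ℝ => F (y + τ • v)) 0 = fderiv ℝ (fderiv ℝ F) y v v ∧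
    iteratedDeriv 3 (fun τ : ℝ => F (y + τ • v)) 0 = thirdDeriv F y v v v := by
  have hy : ContDiffAt ℝ 3 F (y + (0 : ℝ) • v) := by simpa using hF
  have hc : Filter.Tendsto (fun τ : ℝ => y + τ • v) (nhds 0) (nhds (y + (0 : ℝ) • v)) :=
    (_root_.hasDerivAt_line y v 0).continuousAt
  have hev := hc.eventually (hy.eventually (by simp))
  have h1 : deriv (fun τ : ℝ => F (y + τ • v)) =ᶠ[nhds 0] fun τ => fderiv ℝ F (y + τ • v) v := by
    filter_upwards [hev] with τ hτ using hτ.hasDerivAt_line.deriv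
  have h2 : deriv (deriv fun τ : ℝ => F (y + τ • v)) =ᶠ[nhds 0]
      fun τ => fderiv ℝ (fderiv ℝ F) (y + τ • v) v v := by
    filter_upwards [hev, h1.eventuallyEq_nhds] with τ hτ h1τ
    rw [h1τ.deriv_eq, (hτ.hasDerivAt_fderiv_line v).deriv]
  constructor
  · rw [iteratedDeriv_succ, iteratedDeriv_one, h2.eq_of_nhds]
    simp
  · rw [iteratedDeriv_succ, iteratedDeriv_succ, iteratedDeriv_one, h2.deriv_eq,
      (hy.hasDerivAt_fderiv_fderiv_line v v).deriv]
    simp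

/-- The restriction to a line is convex, so its derivative is monotone. -/
theorem fderiv_fderiv_nonneg_of_convexOn {U : Set E} (hU : IsOpen U) (hF : ContDiffOn ℝ 3 F U)
    (hc : ConvexOn ℝ U F) (hy : y ∈ U) (v : E) : 0 ≤ fderiv ℝ (fderiv ℝ F) y v v := by
  have hCD : ∀ z ∈ U, ContDiffAt ℝ 3 F z := fun z hz => hF.contDiffAt (hU.mem_nhds hz)
  set D : Set ℝ := {τ | y + τ • v ∈ U}
  have hD : IsOpen D := hU.preimage (by fun_prop)
  have h0 : (0 : ℝ) ∈ D := by simpa [D] using hy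
  have hconv : ConvexOn ℝ D (fun τ : ℝ => F (y + τ • v)) := by
    have := hc.comp_affineMap (AffineMap.lineMap y (y + v) : ℝ →ᵃ[ℝ] E)
    have hline : ⇑(AffineMap.lineMap y (y + v) : ℝ →ᵃ[ℝ] E) = fun τ : ℝ => y + τ • v := by
      ext τ
      simp [AffineMap.lineMap_apply, add_comm]
    rw [hline] at this
    exact this
  have hmono := hconv.monotoneOn_deriv fun τ hτ => (hCD _ hτ).hasDerivAt_line.differentiableAt
  have h := hmono.derivWithin_nonneg (x := 0)
  rw [derivWithin_of_isOpen hD h0] at h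
  have := (iteratedDeriv_line (hCD y hy) v).1
  rw [iteratedDeriv_succ, iteratedDeriv_one] at this
  rwa [← this]

end Smooth

/-! ### Self-concordance estimates along a segment. -/

namespace ProxNewton

variable {n : ℕ} {f g : EuclideanSpace ℝ (Fin n) → EReal} {x y : EuclideanSpace ℝ (Fin n)}

theorem localNorm_nonneg (f : EuclideanSpace ℝ (Fin n) → EReal) (x u : EuclideanSpace ℝ (Fin n)) :
    0 ≤ localNorm f x u :=
  Real.sqrt_nonneg _

theorem IsSelfConcordant.contDiffAt (hf : IsSelfConcordant f) (hx : x ∈ dom f) :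
    ContDiffAt ℝ 3 (realPart f) x :=
  hf.contDiffOn.contDiffAt (hf.isOpen_dom.mem_nhds hx)

theorem IsSelfConcordant.hess_self_nonneg (hf : IsSelfConcordant f) (hx : x ∈ dom f)
    (u : EuclideanSpace ℝ (Fin n)) : 0 ≤ hess f x u u :=
  fderiv_fderiv_nonneg_of_convexOn hf.isOpen_dom hf.contDiffOn hf.properLscConvex.convex hx u

theorem IsSelfConcordant.hess_smul_add_smul (hf : IsSelfConcordant f) (hx : x ∈ dom f)
    (s t : ℝ) (u p : EuclideanSpace ℝ (Fin n)) :
    hess f x (s • u + t • p) (s • u + t • p) =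
      hess f x u u * s ^ 2 + 2 * hess f x u p * (s * t) + hess f x p p * t ^ 2 := by
  have hc : hess f x p u = hess f x u p := (hf.contDiffAt hx).fderiv_fderiv_comm p u
  have : hess f x (s • u + t • p) (s • u + t • p) =
      hess f x u u * s ^ 2 + (hess f x u p + hess f x p u) * (s * t) + hess f x p p * t ^ 2 := by
    simp only [hess, map_add, map_smul, add_apply, smul_apply, smul_eq_mul]
    ring
  rw [this, hc]
  ring

theorem IsSelfConcordant.hess_sq_le (hf : IsSelfConcordant f) (hx : x ∈ dom f)
    (u p : EuclideanSpace ℝ (Fin n)) : hess f x u p ^ 2 ≤ hess f x u u * hess f x p p := by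
  -- Cauchy–Schwarz by the discriminant, since the Hessian here is only known to be semidefinite.
  have := discrim_le_zero (a := hess f x u u) (b := 2 * hess f x u p) (c := hess f x p p)
    fun s => by
      have h := hf.hess_self_nonneg hx (s • u + (1 : ℝ) • p)
      rw [hf.hess_smul_add_smul hx] at h
      linarith
  rw [discrim] at this
  linarith

theorem IsSelfConcordant.abs_thirdDeriv_self_le (hf : IsSelfConcordant f) (hx : x ∈ dom f)
    (v : EuclideanSpace ℝ (Fin n)) :
    |thirdDeriv (realPart f) x v v v| ≤ 2 * (hess f x v v * √(hess f x v v)) := by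
  have h := (hf.line x hx v).2 0 (by simpa using hx)
  obtain ⟨h2, h3⟩ := iteratedDeriv_line (hf.contDiffAt hx) v
  rw [h2, h3] at h
  refine h.trans_eq ?_
  have hn := hf.hess_self_nonneg hx v
  rw [hess] at hn ⊢
  rw [Real.sqrt_eq_rpow, show (3 / 2 : ℝ) = 1 + 1 / 2 by norm_num,
    Real.rpow_one_add' hn (by norm_num)]

/-- The third derivative of a self-concordant function as a trilinear form is bounded by the local
norm with the constant of the diagonal bound. -/
theorem IsSelfConcordant.abs_thirdDeriv_le (hf : IsSelfConcordant f) (hx : x ∈ dom f)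
    (p u : EuclideanSpace ℝ (Fin n)) :
    |thirdDeriv (realPart f) x p u u| ≤ 2 * (hess f x u u * localNorm f x p) := by
  refine abs_polar_le_of_posSemidef (a := thirdDeriv (realPart f) x u u u)
    (c := thirdDeriv (realPart f) x u p p) (d := thirdDeriv (realPart f) x p p p)
    (hf.hess_self_nonneg hx u) (hf.hess_self_nonneg hx p) (hf.hess_sq_le hx u p) fun s t => ?_
  have h := hf.abs_thirdDeriv_self_le hx (s • u + t • p)
  rwa [thirdDeriv_line_expand (hf.contDiffAt hx), hf.hess_smul_add_smul hx] at h

theorem IsSelfConcordant.line_mem_dom (hf : IsSelfConcordant f) (hx : x ∈ dom f) (hy : y ∈ dom f)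
    {τ : ℝ} (hτ : τ ∈ Set.Icc (0 : ℝ) 1) : x + τ • (y - x) ∈ dom f :=
  hf.properLscConvex.convex.1.add_smul_sub_mem hx hy hτ

theorem IsSelfConcordant.localNorm_line_le (hf : IsSelfConcordant f) (hx : x ∈ dom f)
    (hy : y ∈ dom f) (hr : localNorm f x (y - x) < 1) {τ : ℝ} (hτ : τ ∈ Set.Icc (0 : ℝ) 1) :
    localNorm f (x + τ • (y - x)) (y - x) ≤
      localNorm f x (y - x) / (1 - localNorm f x (y - x) * τ) := by
  have := sqrt_le_div_of_abs_deriv_le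
    (ψ := fun τ => hess f (x + τ • (y - x)) (y - x) (y - x))
    (fun τ hτ => (hf.contDiffAt (hf.line_mem_dom hx hy hτ)).hasDerivAt_fderiv_fderiv_line _ _)
    (fun τ hτ => hf.hess_self_nonneg (hf.line_mem_dom hx hy hτ) _)
    (fun τ hτ => hf.abs_thirdDeriv_self_le (hf.line_mem_dom hx hy hτ) _)
    (by simpa [localNorm] using hr) hτ
  simpa [localNorm] using this

theorem IsSelfConcordant.hess_line_bounds (hf : IsSelfConcordant f) (hx : x ∈ dom f)
    (hy : y ∈ dom f) (hr : localNorm f x (y - x) < 1) {τ : ℝ} (hτ : τ ∈ Set.Icc (0 : ℝ) 1)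
    (u : EuclideanSpace ℝ (Fin n)) :
    hess f x u u * (1 - localNorm f x (y - x) * τ) ^ 2 ≤ hess f (x + τ • (y - x)) u u ∧
      hess f (x + τ • (y - x)) u u * (1 - localNorm f x (y - x) * τ) ^ 2 ≤ hess f x u u := by
  have := le_and_le_of_abs_deriv_le (h := fun τ => hess f (x + τ • (y - x)) u u)
    (localNorm_nonneg f x (y - x)) hr
    (fun τ hτ => (hf.contDiffAt (hf.line_mem_dom hx hy hτ)).hasDerivAt_fderiv_fderiv_line _ _)
    (fun τ hτ => by
      have hm := hf.line_mem_dom hx hy hτ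
      refine (hf.abs_thirdDeriv_le hm _ _).trans ?_
      have h1 := hf.localNorm_line_le hx hy hr hτ
      have h2 := hf.hess_self_nonneg hm u
      exact mul_le_mul_of_nonneg_left (mul_le_mul_of_nonneg_left h1 h2) zero_le_two) hτ
  simpa using this

theorem IsSelfConcordant.localNorm_line_le' (hf : IsSelfConcordant f) (hx : x ∈ dom f)
    (hy : y ∈ dom f) (hr : localNorm f x (y - x) < 1) {τ : ℝ} (hτ : τ ∈ Set.Icc (0 : ℝ) 1)
    (u : EuclideanSpace ℝ (Fin n)) :
    localNorm f (x + τ • (y - x)) u ≤ localNorm f x u / (1 - localNorm f x (y - x) * τ) := by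
  have hp := one_sub_mul_pos (localNorm_nonneg f x (y - x)) hr hτ
  rw [le_div_iff₀ hp]
  have h := Real.sqrt_le_sqrt (hf.hess_line_bounds hx hy hr hτ u).2
  rwa [Real.sqrt_mul (hf.hess_self_nonneg (hf.line_mem_dom hx hy hτ) u), Real.sqrt_sq hp.le] at h

theorem IsSelfConcordant.mul_localNorm_le (hf : IsSelfConcordant f) (hx : x ∈ dom f)
    (hy : y ∈ dom f) (hr : localNorm f x (y - x) < 1) (u : EuclideanSpace ℝ (Fin n)) :
    localNorm f x u * (1 - localNorm f x (y - x)) ≤ localNorm f y u := by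
  have h := Real.sqrt_le_sqrt (hf.hess_line_bounds hx hy hr ⟨zero_le_one, le_rfl⟩ u).1
  simp only [mul_one, one_smul, add_sub_cancel] at h
  rwa [Real.sqrt_mul (hf.hess_self_nonneg hx u), Real.sqrt_sq (by linarith)] at h

/-- The Hessian is taken at the endpoint `y`, as in the Newton model, while the norms are taken at
`x`. -/
theorem IsSelfConcordant.abs_grad_sub_sub_hess_le (hf : IsSelfConcordant f) (hx : x ∈ dom f)
    (hy : y ∈ dom f) (hr : localNorm f x (y - x) < 1) (u : EuclideanSpace ℝ (Fin n)) :
    |grad f y u - grad f x u - hess f y (y - x) u| ≤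
      (localNorm f x (y - x) / (1 - localNorm f x (y - x))) ^ 2 * localNorm f x u := by
  set p := y - x with hp
  set r := localNorm f x p with hrdef
  have hr0 : 0 ≤ r := Real.sqrt_nonneg _
  have key := abs_le_of_abs_deriv_le_cubic (r := r) (N := localNorm f x u)
    (k := fun τ => grad f (x + τ • p) u - grad f x u - τ * hess f (x + τ • p) p u)
    -- The two Hessian terms cancel in the product rule, leaving only the third derivative.
    (k' := fun τ => -(τ * thirdDeriv (realPart f) (x + τ • p) p p u)) hr0 hr (by simp)
    (fun τ hτ => by
      have hC := hf.contDiffAt (hf.line_mem_dom hx hy hτ)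
      have h1 := (hC.hasDerivAt_fderiv_line u).sub_const (grad f x u)
      have h2 := (hasDerivAt_id τ).fun_mul (hC.hasDerivAt_fderiv_fderiv_line p u)
      refine (h1.fun_sub h2).congr_deriv ?_
      simp only [id, one_mul]
      rw [← hp]
      ring)
    (fun τ hτ => by
      have hm := hf.line_mem_dom hx hy hτ
      have hq := one_sub_mul_pos hr0 hr hτ
      have h1 := hf.abs_thirdDeriv_le hm u p
      have hsymm : thirdDeriv (realPart f) (x + τ • p) p p u
          = thirdDeriv (realPart f) (x + τ • p) u p p := by
        rw [(hf.contDiffAt hm).thirdDeriv_comm_right, (hf.contDiffAt hm).thirdDeriv_comm_left]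
      have h2 := hf.localNorm_line_le hx hy hr hτ
      have h3 := hf.localNorm_line_le' hx hy hr hτ u
      have h4 : hess f (x + τ • p) p p = localNorm f (x + τ • p) p ^ 2 :=
        (Real.sq_sqrt (hf.hess_self_nonneg hm p)).symm
      have hn0 : 0 ≤ localNorm f (x + τ • p) p := Real.sqrt_nonneg _
      have hn1 : 0 ≤ localNorm f (x + τ • p) u := Real.sqrt_nonneg _
      have hτ0 := hτ.1
      rw [abs_neg, abs_mul, abs_of_nonneg hτ.1, hsymm]
      calc τ * |thirdDeriv (realPart f) (x + τ • p) u p p|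
          ≤ τ * (2 * (localNorm f (x + τ • p) p ^ 2 * localNorm f (x + τ • p) u)) := by
            rw [← h4]; gcongr
        _ ≤ τ * (2 * ((r / (1 - r * τ)) ^ 2 * (localNorm f x u / (1 - r * τ)))) := by gcongr
        _ = _ := by
          have := hq.ne'
          field_simp)
  have hxy : x + p = y := by rw [hp]; abel
  simpa [hxy] using key

/-! ### Optimality conditions for the objective and its model. -/

theorem IsProperLscConvex.coe_realPart (hf : IsProperLscConvex f) (hx : x ∈ dom f) :
    (realPart f x : EReal) = f x :=
  EReal.coe_toReal (ne_of_lt hx) (hf.ne_bot x)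

theorem objective_eq_coe (hf : IsProperLscConvex f) (hg : IsProperLscConvex g) (t : ℝ)
    (hx : x ∈ domF f g) :
    objective f g t x = ((realPart f x + t⁻¹ * realPart g x : ℝ) : EReal) := by
  rw [objective, ← hf.coe_realPart hx.1, ← hg.coe_realPart hx.2]
  norm_cast

theorem modelObjective_eq_coe (hg : IsProperLscConvex g) (t : ℝ) {z : EuclideanSpace ℝ (Fin n)}
    (hx : x ∈ dom g) :
    modelObjective f g t z x = ((quadModel f z x + t⁻¹ * realPart g x : ℝ) : EReal) := by
  rw [modelObjective, ← hg.coe_realPart hx]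
  norm_cast

/-- On the segment to `y`, convexity puts `g` below its chord. The objective with `g` replaced by
the chord still has its minimum at the start, so its right derivative there is nonnegative. -/
theorem IsSolution.grad_add_nonneg (hf : IsSelfConcordant f) (hg : IsProperLscConvex g) {t : ℝ}
    (ht : 0 < t) (hx : IsSolution f g t x) (hy : y ∈ domF f g) :
    0 ≤ grad f x (y - x) + t⁻¹ * (realPart g y - realPart g x) := by
  have hC : ContDiffAt ℝ 3 (realPart f) (x + (0 : ℝ) • (y - x)) := by
    simpa using hf.contDiffAt hx.1.1
  have hder : HasDerivAt (fun s : ℝ => realPart f (x + s • (y - x))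
      + s * (t⁻¹ * (realPart g y - realPart g x)))
      (grad f x (y - x) + t⁻¹ * (realPart g y - realPart g x)) 0 := by
    have := hC.hasDerivAt_line.fun_add
      ((hasDerivAt_id (0 : ℝ)).mul_const (t⁻¹ * (realPart g y - realPart g x)))
    simpa [grad] using this
  refine ge_of_tendsto ((hasDerivWithinAt_iff_tendsto_slope' Set.self_notMem_Ioi).1
    (hder.hasDerivWithinAt (s := Set.Ioi 0))) ?_
  filter_upwards [Ioc_mem_nhdsGT (zero_lt_one' ℝ)] with s hs
  have hsI : s ∈ Set.Icc (0 : ℝ) 1 := Set.Ioc_subset_Icc_self hs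
  have hm : x + s • (y - x) ∈ domF f g :=
    ⟨hf.line_mem_dom hx.1.1 hy.1 hsI, hg.convex.1.add_smul_sub_mem hx.1.2 hy.2 hsI⟩
  have hmin := hx.2 (x + s • (y - x))
  rw [objective_eq_coe hf.properLscConvex hg t hx.1, objective_eq_coe hf.properLscConvex hg t hm,
    EReal.coe_le_coe_iff] at hmin
  have hgc : realPart g (x + s • (y - x)) ≤ (1 - s) * realPart g x + s * realPart g y := by
    have h := hg.convex.2 hx.1.2 hy.2 (sub_nonneg.2 hs.2) hs.1.le (sub_add_cancel 1 s)
    have e : (1 - s) • x + s • y = x + s • (y - x) := by module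
    rwa [e] at h
  have h1 := mul_le_mul_of_nonneg_left hgc (inv_pos.2 ht).le
  rw [slope_def_field]
  refine div_nonneg ?_ (by linarith [hs.1])
  simp only [zero_smul, add_zero, zero_mul]
  linarith

/-- Comparing the `δ`-solution with the minimizer of the composite objective. -/
theorem IsDeltaSolution.hess_add_le {t δ : ℝ} {z xstar xplus : EuclideanSpace ℝ (Fin n)}
    (h : IsDeltaSolution f g t δ z xplus) (hf : IsSelfConcordant f) (hg : IsProperLscConvex g)
    (ht : 0 < t) (hz : z ∈ dom f) (hstar : IsSolution f g t xstar) :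
    hess f z (xplus - xstar) (xplus - xstar) ≤ δ ^ 2 - 2 * (grad f z (xplus - xstar)
      - grad f xstar (xplus - xstar) - hess f z (z - xstar) (xplus - xstar)) := by
  have h1 := h.2 xstar hstar.1
  rw [modelObjective_eq_coe hg t h.1.2, modelObjective_eq_coe hg t hstar.1.2, ← EReal.coe_add,
    EReal.coe_le_coe_iff] at h1
  have h2 := hstar.grad_add_nonneg hf hg ht h.1
  -- In terms of `d` and `p` the model difference expands in the Hessian at `z`, and the `p, p`
  -- terms cancel.
  obtain ⟨d, rfl⟩ : ∃ d, xplus = xstar + d := ⟨xplus - xstar, by abel⟩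
  obtain ⟨p, rfl⟩ : ∃ p, z = xstar + p := ⟨z - xstar, by abel⟩
  have e1 : xstar + d - (xstar + p) = (1 : ℝ) • d + (-1 : ℝ) • p := by module
  have e2 : xstar - (xstar + p) = (0 : ℝ) • d + (-1 : ℝ) • p := by module
  have hc : hess f (xstar + p) d p = hess f (xstar + p) p d :=
    (hf.contDiffAt hz).fderiv_fderiv_comm d p
  have hl : ∀ s r : ℝ, grad f (xstar + p) (s • d + r • p)
      = s * grad f (xstar + p) d + r * grad f (xstar + p) p := fun s r => by
    simp only [grad, map_add, map_smul, smul_eq_mul]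
  simp only [quadModel, e1, e2, hf.hess_smul_add_smul hz, hl, hc] at h1
  simp only [add_sub_cancel_left] at h2 ⊢
  linarith

/-! ### The scalar bound and its monotonicity. -/

theorem one_sub_four_mul_add_pos {lam : ℝ} (h : lam ∈ Set.Ico (0 : ℝ) (1 - √2 / 2)) :
    lam < 1 ∧ 0 < 1 - 4 * lam + 2 * lam ^ 2 := by
  have hs := Real.sq_sqrt (zero_le_two (α := ℝ))
  have hs0 : 0 < √2 := Real.sqrt_pos.2 two_pos
  have h2 := h.2
  refine ⟨by linarith, ?_⟩
  have h3 : √2 / 2 < 1 - lam := by linarith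
  have h4 := mul_self_lt_mul_self (by positivity) h3
  linarith

theorem contractionBound_ge {δ lam : ℝ} (h : lam ∈ Set.Ico (0 : ℝ) (1 - √2 / 2)) :
    δ / (1 - lam) + 2 * lam ^ 2 / (1 - lam) ^ 4 ≤ contractionBound δ lam := by
  obtain ⟨h1, hden⟩ := one_sub_four_mul_add_pos h
  have h0 := h.1
  have hl : 0 < 1 - lam := by linarith
  have hs : (1 : ℝ) < √2 := by rw [Real.lt_sqrt zero_le_one]; norm_num
  have hhalf : lam < 1 / 2 := by linarith [h.2]
  have key : 2 / (1 - lam) ^ 4 ≤ (3 - 2 * lam) / (1 - 4 * lam + 2 * lam ^ 2) := by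
    rw [div_le_div_iff₀ (pow_pos hl 4) hden]
    -- The difference is `4λ²(1-λ) + λ⁴`. The other ingredient is `2 ≤ 3 - 2λ`, from `λ < 1/2`.
    have hq : 1 - 4 * lam + 2 * lam ^ 2 ≤ (1 - lam) ^ 4 := by
      nlinarith [mul_nonneg (sq_nonneg lam) hl.le, sq_nonneg (lam ^ 2)]
    calc 2 * (1 - 4 * lam + 2 * lam ^ 2) ≤ (3 - 2 * lam) * (1 - 4 * lam + 2 * lam ^ 2) := by
          gcongr; linarith
      _ ≤ (3 - 2 * lam) * (1 - lam) ^ 4 := by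
          gcongr; linarith
  have := mul_le_mul_of_nonneg_right key (sq_nonneg lam)
  rw [contractionBound]
  have e : 2 * lam ^ 2 / (1 - lam) ^ 4 = 2 / (1 - lam) ^ 4 * lam ^ 2 := by ring
  rw [e]
  linarith

theorem monotoneOn_contractionBound_right {δ : ℝ} (hδ : 0 ≤ δ) :
    MonotoneOn (fun lam : ℝ => contractionBound δ lam) (Set.Ico (0 : ℝ) (1 - √2 / 2)) := by
  intro a ha b hb hab
  obtain ⟨ha1, hda⟩ := one_sub_four_mul_add_pos ha
  obtain ⟨hb1, hdb⟩ := one_sub_four_mul_add_pos hb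
  have ha0 := ha.1
  have hb0 := hb.1
  simp only [contractionBound, div_mul_eq_mul_div]
  have hn : (3 - 2 * a) * a ^ 2 ≤ (3 - 2 * b) * b ^ 2 := by
    have e : (3 - 2 * b) * b ^ 2 - (3 - 2 * a) * a ^ 2
        = (b - a) * (2 * a * (1 - a) + 2 * b * (1 - b) + a * (1 - b) + b * (1 - a)) := by ring
    have := mul_nonneg (sub_nonneg.2 hab) (by
      have := sub_nonneg.2 ha1.le
      have := sub_nonneg.2 hb1.le
      positivity : 0 ≤ 2 * a * (1 - a) + 2 * b * (1 - b) + a * (1 - b) + b * (1 - a))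
    linarith
  have hd : 1 - 4 * b + 2 * b ^ 2 ≤ 1 - 4 * a + 2 * a ^ 2 := by
    nlinarith [mul_nonneg (sub_nonneg.2 hab) (by linarith : 0 ≤ 2 - a - b)]
  have hnb : 0 ≤ (3 - 2 * b) * b ^ 2 := mul_nonneg (by linarith) (sq_nonneg b)
  have hb1' : 0 < 1 - b := by linarith
  gcongr

theorem monotoneOn_contractionBound_left {lam : ℝ} (h : lam ∈ Set.Ico (0 : ℝ) (1 - √2 / 2)) :
    MonotoneOn (fun δ : ℝ => contractionBound δ lam) (Set.Ici (0 : ℝ)) := by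
  intro a _ b _ hab
  have hl : 0 < 1 - lam := sub_pos.2 (one_sub_four_mul_add_pos h).1
  simp only [contractionBound]
  gcongr

/-! ### Assembling the contraction estimate. -/

theorem IsDeltaSolution.localNorm_le {t δ : ℝ} {z xstar xplus : EuclideanSpace ℝ (Fin n)}
    (h : IsDeltaSolution f g t δ z xplus) (hf : IsSelfConcordant f) (hg : IsProperLscConvex g)
    (ht : 0 < t) (hδ : 0 ≤ δ) (hz : z ∈ dom f) (hstar : IsSolution f g t xstar)
    (hlam : localNorm f xstar (z - xstar) < 1) :
    localNorm f xstar (xplus - xstar) ≤ δ / (1 - localNorm f xstar (z - xstar))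
      + 2 * localNorm f xstar (z - xstar) ^ 2 / (1 - localNorm f xstar (z - xstar)) ^ 4 := by
  have h1 := h.hess_add_le hf hg ht hz hstar
  have h2 := hf.abs_grad_sub_sub_hess_le hstar.1.1 hz hlam (xplus - xstar)
  have h3 := hf.mul_localNorm_le hstar.1.1 hz hlam (xplus - xstar)
  have h4 : hess f z (xplus - xstar) (xplus - xstar) = localNorm f z (xplus - xstar) ^ 2 :=
    (Real.sq_sqrt (hf.hess_self_nonneg hz _)).symm
  have h5 := (abs_le.1 h2).1
  have hD0 := localNorm_nonneg f xstar (xplus - xstar)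
  have hl0 := localNorm_nonneg f xstar (z - xstar)
  rw [h4] at h1
  set D := localNorm f xstar (xplus - xstar)
  set lam := localNorm f xstar (z - xstar)
  have hm : 0 < 1 - lam := by linarith
  set X := D * (1 - lam) with hX
  have hX0 : 0 ≤ X := by positivity
  set R := lam ^ 2 / (1 - lam) ^ 3 with hR
  have hR0 : 0 ≤ R := by positivity
  have hE : (lam / (1 - lam)) ^ 2 * D = R * X := by
    rw [hR, hX]
    field_simp
  rw [hE] at h5
  have h6 : X ^ 2 ≤ δ ^ 2 + 2 * (R * X) := by
    have := pow_le_pow_left₀ hX0 h3 2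
    linarith
  -- Otherwise `X - 2R > δ` and `X > δ + 2R`, so `X(X - 2R)` exceeds `δ²`.
  have h7 : X ≤ δ + 2 * R := by
    by_contra! hlt
    nlinarith [mul_nonneg hδ hR0]
  have e : δ / (1 - lam) + 2 * lam ^ 2 / (1 - lam) ^ 4 = (δ + 2 * R) / (1 - lam) := by
    rw [hR]
    field_simp
  rw [e, le_div_iff₀ hm]
  exact h7

end ProxNewton

theorem theorem3p2 {n : ℕ} (f g : EuclideanSpace ℝ (Fin n) → EReal) (ν t δ : ℝ)
    (hf : ProxNewton.IsSelfConcordantBarrier ν f)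
    (hg : ProxNewton.IsProperLscConvex g)
    (ht : 0 < t) (hδ : 0 ≤ δ)
    (xt xplus xstar : EuclideanSpace ℝ (Fin n))
    (hxt : xt ∈ ProxNewton.domF f g)
    (hxstar : ProxNewton.IsSolution f g t xstar)
    (hpos : ProxNewton.HessPosDef f xstar)
    (hxplus : ProxNewton.IsDeltaSolution f g t δ xt xplus) :
    (ProxNewton.localNorm f xstar (xt - xstar) ∈ Set.Ico (0 : ℝ) (1 - Real.sqrt 2 / 2) →
      ProxNewton.localNorm f xstar (xplus - xstar) ≤
        ProxNewton.contractionBound δ (ProxNewton.localNorm f xstar (xt - xstar))) ∧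
    (∀ δ' : ℝ, 0 ≤ δ' →
      MonotoneOn (fun lam : ℝ => ProxNewton.contractionBound δ' lam)
        (Set.Ico (0 : ℝ) (1 - Real.sqrt 2 / 2))) ∧
    (∀ lam ∈ Set.Ico (0 : ℝ) (1 - Real.sqrt 2 / 2),
      MonotoneOn (fun δ' : ℝ => ProxNewton.contractionBound δ' lam) (Set.Ici (0 : ℝ))) := by
  have hsc := hf.selfConcordant
  refine ⟨fun hlam => ?_, fun δ' hδ' => ProxNewton.monotoneOn_contractionBound_right hδ',
    fun lam hlam => ProxNewton.monotoneOn_contractionBound_left hlam⟩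
  exact (hxplus.localNorm_le hsc hg ht hδ hxt.1 hxstar
    (ProxNewton.one_sub_four_mul_add_pos hlam).1).trans (ProxNewton.contractionBound_ge hlam)
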